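/- Let $0\le\alpha\le\pi$. A treasure and an exit lie at unknown points of the boundary of the closed unit disk, at known arc distance $\alpha$ (the length of the shorter arc between them). Two robots start at the center of the disk at time $0$, share a clock and a coordinate system, and move in the disk with speed at most $1$, independently of each other. A robot detects the treasure or the exit only when it is exactly at that point. A robot that is at the treasure may pick it up, carry it, drop it, or hand it over; otherwise the treasure is at rest. In the face-to-face problem 2-TE$_{f2f}$ the robots can exchange information only when they are at the same point. A (deterministic) algorithm prescribes how the robots move and handle the treasure, where the actions of each robot at any time depend only on what it has itself observed, and on what the other robot has told it at meetings, up to that time. The evacuation time of a placement of treasure and exit is the first time at which a robot is at the exit with the treasure ($+\infty$ if this never happens), and the time that the algorithm needs is the supremum of its evacuation times over all placements at arc distance $\alpha$. **Theorem (face-to-face lower bound).** Every algorithm for 2-TE$_{f2f}$ needs time at least $$1+\frac{\pi}{3}+4\sin\frac{\alpha}{2}\quad\text{if } 0\le\alpha\le\frac{2\pi}{3},$$ and at least $$1+\frac{\pi}{3}+2\sin\alpha+2\sin\frac{\alpha}{2}\quad\text{if } \frac{2\pi}{3}\le\alpha\le\pi .$$ -/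

import Mathlib

open scoped NNReal ENNReal

namespace TreasureEvacuation

/-- A placement of the treasure and of the exit on the perimeter of the unit disk of the plane `ℂ`,
at arc distance `α` from each other. For two points of the unit circle the (unoriented) angle is
the length of the shorter arc between them. -/
structure Placement (α : ℝ) where
  treasure : ℂ
  exit : ℂ
  norm_treasure : ‖treasure‖ = 1
  norm_exit : ‖exit‖ = 1
  arc : InnerProductGeometry.angle treasure exit = α

/-- The things that move: the two robots and the treasure. -/
inductive Body where
  | robot (i : Fin 2)
  | treasure

/-- What the robots do with each placement: the trajectories of the two robots and the trajectory
of the treasure, for all times `t ≥ 0`. -/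
structure Behaviour (α : ℝ) where
  robot : Placement α → Fin 2 → ℝ≥0 → ℂ
  treasure : Placement α → ℝ≥0 → ℂ

/-- The flow of information in the face-to-face model, for two placements `P` and `Q`.

`Differs B P Q (.robot i) t`: what robot `i` has seen and has been told up to time `t` (inclusive)
is not the same under `P` as under `Q`. A robot sees a point only when it is exactly there, and it
is told something only when it is at the same point as the other robot, in which case it learns all
that the other robot knows.

`Differs B P Q .treasure t`: there is a cause for the treasure not to be at the same point at time
`t` under `P` and under `Q`; either it was hidden at two different points, or it was handled by
a robot whose information differs.

The predicate is the least one with these closure properties, so every difference goes back, by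
finitely many steps, to a robot that passed over the exit or over the treasure. In particular
a robot never gains information by its own decisions. -/
inductive Differs {α : ℝ} (B : Behaviour α) (P Q : Placement α) : Body → ℝ≥0 → Prop
  /-- Robot `i` is at the exit under one placement; under the other one the exit is elsewhere. -/
  | seeExit (i : Fin 2) (t : ℝ≥0) :
      P.exit ≠ Q.exit → (B.robot P i t = P.exit ∨ B.robot Q i t = Q.exit) →
      Differs B P Q (.robot i) t
  /-- Robot `i` is at the treasure under one placement; under the other one the treasure is
  elsewhere at that time. -/
  | seeTreasure (i : Fin 2) (t : ℝ≥0) :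
      Differs B P Q .treasure t → B.treasure P t ≠ B.treasure Q t →
      (B.robot P i t = B.treasure P t ∨ B.robot Q i t = B.treasure Q t) →
      Differs B P Q (.robot i) t
  /-- Robot `i` meets robot `j`, whose information differs. -/
  | meet (i j : Fin 2) (t : ℝ≥0) :
      Differs B P Q (.robot j) t →
      (B.robot P i t = B.robot P j t ∨ B.robot Q i t = B.robot Q j t) →
      Differs B P Q (.robot i) t
  /-- Robots do not forget. -/
  | remember (i : Fin 2) (s t : ℝ≥0) :
      s ≤ t → Differs B P Q (.robot i) s → Differs B P Q (.robot i) t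
  /-- The treasure is hidden at two different points. -/
  | hidden : P.treasure ≠ Q.treasure → Differs B P Q .treasure 0
  /-- A robot whose information differs is at the treasure: it may pick up, keep or drop it. -/
  | handle (i : Fin 2) (t : ℝ≥0) :
      Differs B P Q (.robot i) t →
      (B.robot P i t = B.treasure P t ∨ B.robot Q i t = B.treasure Q t) →
      Differs B P Q .treasure t
  /-- The effect lasts as long as the two positions of the treasure stay apart; the treasure
  has no other memory. -/
  | apart (s t : ℝ≥0) :
      s ≤ t → (∀ u, s < u → u ≤ t → B.treasure P u ≠ B.treasure Q u) →
      Differs B P Q .treasure s → Differs B P Q .treasure t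

/-- A (deterministic) algorithm for two robots in the face-to-face model that know the arc distance
`α` of treasure and exit but not their positions. The robots share a clock and a coordinate
system, may follow different rules, and may pick up, drop and hand over the treasure. -/
structure F2FAlgorithm (α : ℝ) extends Behaviour α where
  /-- The robots start at the center. -/
  robot_zero : ∀ P i, robot P i 0 = 0
  /-- The robots stay in the unit disk. -/
  robot_mem : ∀ P i t, ‖robot P i t‖ ≤ 1
  /-- The robots have maximum speed `1`. -/
  robot_speed : ∀ P i, LipschitzWith 1 (robot P i)
  /-- The treasure starts where it is hidden. -/
  treasure_zero : ∀ P, treasure P 0 = P.treasure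
  /-- The treasure does not move faster than the robots. -/
  treasure_speed : ∀ P, LipschitzWith 1 (treasure P)
  /-- The treasure is at rest as long as no robot is with it. -/
  treasure_rest : ∀ P (s t : ℝ≥0), s ≤ t →
    (∀ u, s ≤ u → u ≤ t → ∀ i, robot P i u ≠ treasure P u) → treasure P s = treasure P t
  /-- The motion of a robot depends only on the information that it has. -/
  robot_causal : ∀ P Q i t, ¬ Differs toBehaviour P Q (.robot i) t → robot P i t = robot Q i t
  /-- So does what the robots do with the treasure. -/
  treasure_causal : ∀ P Q t, ¬ Differs toBehaviour P Q .treasure t → treasure P t = treasure Q t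

namespace F2FAlgorithm

variable {α : ℝ}

/-- At time `t` the treasure is at the exit, together with a robot. (The robot matters only if
treasure and exit are at the same point from the start: the treasure still has to be found.) -/
def Evacuated (A : F2FAlgorithm α) (P : Placement α) (t : ℝ≥0) : Prop :=
  A.treasure P t = P.exit ∧ ∃ i, A.robot P i t = P.exit

/-- The evacuation time for the placement `P` (`⊤` if the treasure is never brought to the
exit). -/
noncomputable def evacuationTime (A : F2FAlgorithm α) (P : Placement α) : ℝ≥0∞ :=
  ⨅ (t : ℝ≥0) (_ : A.Evacuated P t), (t : ℝ≥0∞)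

/-- The time that the algorithm needs: the supremum of its evacuation times over all placements. -/
noncomputable def worstCaseTime (A : F2FAlgorithm α) : ℝ≥0∞ :=
  ⨆ P : Placement α, A.evacuationTime P

end F2FAlgorithm

end TreasureEvacuation

namespace TreasureEvacuation

open MeasureTheory Set Real

/-! A robot reaches the circle at time `1` at the earliest, so before time `1 + π / 3` the two
robots have explored less than a third of it. Hence at any `t₀ < 1 + π / 3` some `x`, `x + α`, `x +
2α` are all unvisited (`exists_three_unvisited`). Three placements use only these points, each with
its treasure at a different one, and their runs agree up to `t₀`.

After `t₀`, news from these points travels with speed at most one, so at any time a robot is at the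
same place in two of the runs unless it lies in both within the cone of a common point
(`robot_eq_or_inCone`). Let `m` bound the three mutual distances from below. If each treasure were
reached before `t₀ + m`, the same robot would reach two of them, in two of the runs. It would then
have to cover a distance of at least `m` in less time (`not_forall_visited`). So one treasure is
still untouched just before `t₀ + m`, and carrying it to the exit takes `2 sin (α / 2)` more
(`Evacuated.exists_visit`). The best `m` is the smaller of the chords `2 sin (α / 2)` and `2 sin α`;
they cross at `α = 2π / 3`. -/

instance fact_two_pi_pos : Fact (0 < 2 * π) := ⟨Real.two_pi_pos⟩

/-! ### Measure of the explored part of the circle -/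

/-- The point of the unit circle with a given angle. -/
noncomputable def circlePoint (x : AddCircle (2 * π)) : ℂ :=
  (AddCircle.homeomorphCircle' x : ℂ)

lemma continuous_circlePoint : Continuous circlePoint :=
  continuous_subtype_val.comp AddCircle.homeomorphCircle'.continuous

lemma norm_circlePoint (x : AddCircle (2 * π)) : ‖circlePoint x‖ = 1 := Circle.norm_coe _

lemma circlePoint_coe (θ : ℝ) : circlePoint (θ : AddCircle (2 * π)) = Complex.exp (θ * Complex.I) := by
  rw [circlePoint, AddCircle.homeomorphCircle'_apply_mk, Circle.coe_exp]

lemma norm_exp_sub_exp (x y : ℝ) :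
    ‖Complex.exp (x * Complex.I) - Complex.exp (y * Complex.I)‖ = 2 * |sin ((x - y) / 2)| := by
  have h : Complex.exp (x * Complex.I) - Complex.exp (y * Complex.I)
      = Complex.exp (Complex.I * y) * (Complex.exp (Complex.I * ((x - y : ℝ) : ℂ)) - 1) := by
    rw [mul_sub, ← Complex.exp_add]
    push_cast
    ring_nf
  rw [h, norm_mul, Complex.norm_exp_I_mul_ofReal, Complex.norm_exp_I_mul_ofReal_sub_one, one_mul,
    norm_mul]
  simp

lemma norm_circlePoint_coe_sub (x y : ℝ) :
    ‖circlePoint (x : AddCircle (2 * π)) - circlePoint (y : AddCircle (2 * π))‖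
      = 2 * |sin ((x - y) / 2)| := by
  rw [circlePoint_coe, circlePoint_coe, norm_exp_sub_exp]

/-- On short arcs the arc length is almost the chord length. -/
lemma arc_le_chord {δ : ℝ} (x y : ℝ) (h : |x - y| ≤ δ) :
    (1 - δ ^ 2) * |x - y| ≤ ‖Complex.exp (x * Complex.I) - Complex.exp (y * Complex.I)‖ := by
  rw [norm_exp_sub_exp]
  set u := |(x - y) / 2| with hu
  have hu0 : 0 ≤ u := abs_nonneg _
  have h2 : |x - y| = 2 * u := by rw [hu, abs_div]; simp; ring
  have h3 : u - u ^ 3 / 6 ≤ |sin ((x - y) / 2)| := by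
    refine (Real.sin_ge_sub_cube hu0).trans ?_
    rcases abs_cases ((x - y) / 2) with ⟨h, -⟩ | ⟨h, -⟩
    · rw [hu, h]; exact le_abs_self _
    · rw [hu, h, Real.sin_neg]; exact neg_le_abs _
  rw [h2] at h ⊢
  have h4 : u * (4 * u ^ 2) ≤ u * δ ^ 2 := by
    apply mul_le_mul_of_nonneg_left _ hu0
    nlinarith
  nlinarith [pow_nonneg hu0 3]

/-- A unit speed curve that starts at the center explores at most the angle `t - 1` of the unit
circle up to time `t`. (The factor close to one is for convenience.) -/
lemma volume_visited_le {γ : ℝ → ℂ} (hγ : LipschitzWith 1 γ) (h0 : γ 0 = 0) (t : ℝ) {δ : ℝ}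
    (hδ : 0 < δ) (hδ1 : δ < 1) :
    volume {x : AddCircle (2 * π) | ∃ s ∈ Icc 0 t, γ s = circlePoint x}
      ≤ ENNReal.ofReal ((1 - δ ^ 2)⁻¹ * (t - 1)) := by
  have hk : 0 < 1 - δ ^ 2 := by nlinarith
  set V := {x : AddCircle (2 * π) | ∃ s ∈ Icc 0 t, γ s = circlePoint x} with hV
  have hVc : IsClosed V := by
    have : V = circlePoint ⁻¹' (γ '' Icc 0 t) := by
      ext x; simp [hV]
    rw [this]
    exact ((isCompact_Icc.image hγ.continuous).isClosed).preimage continuous_circlePoint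
  -- Sorting times by windows of width `δ` for the argument makes `arg` Lipschitz on each piece with
  -- constant near one, and avoids its branch cut.
  let T : ℤ → Set ℝ := fun k => {s | s ∈ Icc 1 t ∧ ‖γ s‖ = 1 ∧ ⌊(γ s).arg / δ⌋ = k}
  have harg : Measurable fun s => ⌊(γ s).arg / δ⌋ :=
    Int.measurable_floor.comp ((Complex.measurable_arg.comp hγ.continuous.measurable).div_const δ)
  have hTm : ∀ k, MeasurableSet (T k) := fun k =>
    measurableSet_Icc.inter <|
      (hγ.continuous.norm.measurable (measurableSet_singleton (1 : ℝ))).inter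
        (harg (measurableSet_singleton k))
  have hexp : ∀ z : ℂ, ‖z‖ = 1 → Complex.exp (z.arg * Complex.I) = z := fun z hz => by
    simpa [hz] using Complex.norm_mul_exp_arg_mul_I z
  have hLip : ∀ k, LipschitzOnWith (1 - δ ^ 2)⁻¹.toNNReal (fun s => (γ s).arg) (T k) := by
    intro k
    refine LipschitzOnWith.of_dist_le_mul ?_
    rintro s ⟨-, hs, hsk⟩ s' ⟨-, hs', hsk'⟩
    rw [Real.coe_toNNReal _ (inv_nonneg.2 hk.le), Real.dist_eq, le_inv_mul_iff₀ hk]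
    have h1 : |(γ s).arg - (γ s').arg| ≤ δ := by
      have h := Int.abs_sub_lt_one_of_floor_eq_floor (hsk.trans hsk'.symm)
      rw [← sub_div, abs_div, abs_of_pos hδ, div_lt_one hδ] at h
      exact h.le
    have h2 := arc_le_chord _ _ h1
    rw [hexp _ hs, hexp _ hs', ← dist_eq_norm] at h2
    refine h2.trans ?_
    simpa using hγ.dist_le_mul s s'
  have hpre : volume V = volume ((fun θ : ℝ => (θ : AddCircle (2 * π))) ⁻¹' V ∩
      Ioc (-π) (-π + 2 * π)) := by
    have := (AddCircle.measurePreserving_mk (2 * π) (-π)).measure_preimage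
      hVc.measurableSet.nullMeasurableSet
    rw [← this, Measure.restrict_apply]
    exact (AddCircle.measurable_mk') hVc.measurableSet
  have hsub : (fun θ : ℝ => (θ : AddCircle (2 * π))) ⁻¹' V ∩ Ioc (-π) (-π + 2 * π)
      ⊆ ⋃ k, (fun s => (γ s).arg) '' T k := by
    rintro θ ⟨⟨s, ⟨hs0, hst⟩, hs⟩, hθ⟩
    have hn : ‖γ s‖ = 1 := by rw [hs, norm_circlePoint]
    refine mem_iUnion.2 ⟨⌊(γ s).arg / δ⌋, s, ⟨⟨?_, hst⟩, hn, rfl⟩, ?_⟩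
    · have := hγ.dist_le_mul s 0
      simpa [h0, hn, abs_of_nonneg hs0] using this
    · change (γ s).arg = θ
      rw [hs, circlePoint_coe]
      rw [Complex.arg_exp_mul_I, toIocMod_eq_self]
      convert! hθ using 2
  calc volume V ≤ volume (⋃ k, (fun s => (γ s).arg) '' T k) := hpre.trans_le (measure_mono hsub)
    _ ≤ ∑' k, volume ((fun s => (γ s).arg) '' T k) := measure_iUnion_le _
    _ ≤ ∑' k, ENNReal.ofReal (1 - δ ^ 2)⁻¹ * volume (T k) := by
        refine ENNReal.tsum_le_tsum fun k => ?_
        have := (hLip k).hausdorffMeasure_image_le (d := 1) zero_le_one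
        simpa [hausdorffMeasure_real, ENNReal.ofReal] using this
    _ = ENNReal.ofReal (1 - δ ^ 2)⁻¹ * volume (⋃ k, T k) := by
        rw [ENNReal.tsum_mul_left, measure_iUnion _ hTm]
        intro j k hjk
        exact disjoint_left.2 fun s hj hk' => hjk (hj.2.2.symm.trans hk'.2.2)
    _ ≤ ENNReal.ofReal (1 - δ ^ 2)⁻¹ * volume (Icc 1 t) := by
        gcongr
        exact iUnion_subset fun k s hs => hs.1
    _ = ENNReal.ofReal ((1 - δ ^ 2)⁻¹ * (t - 1)) := by
        rw [Real.volume_Icc, ← ENNReal.ofReal_mul (inv_nonneg.2 hk.le)]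

/-- The part of the unit circle within distance `r` of any point is small. -/
lemma volume_near_le (p : ℂ) (r : ℝ) :
    volume {x : AddCircle (2 * π) | ‖circlePoint x - p‖ ≤ r} ≤ ENNReal.ofReal (2 * (π * r)) := by
  rcases eq_empty_or_nonempty {x : AddCircle (2 * π) | ‖circlePoint x - p‖ ≤ r} with h | ⟨y, hy⟩
  · simp [h]
  have hsub : {x : AddCircle (2 * π) | ‖circlePoint x - p‖ ≤ r} ⊆ Metric.closedBall y (π * r) := by
    intro x hx
    have hxy : ‖circlePoint x - circlePoint y‖ ≤ 2 * r := by
      have := norm_sub_le_norm_sub_add_norm_sub (circlePoint x) p (circlePoint y)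
      rw [norm_sub_rev p] at this
      simp only [mem_ofPred_eq] at hx hy
      linarith
    obtain ⟨b, rfl⟩ := QuotientAddGroup.mk_surjective y
    obtain ⟨a, ha, hab⟩ := AddCircle.coe_image_Ioc_eq (2 * π) (-π) ▸ mem_univ (x - (b : AddCircle (2 * π)))
    have hx' : x = ((a + b : ℝ) : AddCircle (2 * π)) := by
      rw [AddCircle.coe_add, hab, sub_add_cancel]
    have hab' : |a| ≤ π := abs_le.2 ⟨ha.1.le, by linarith [ha.2]⟩
    have h1 : 2 * |sin (a / 2)| ≤ 2 * r := by
      have h2 := norm_circlePoint_coe_sub (a + b) b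
      rw [add_sub_cancel_right] at h2
      rw [← h2, ← hx']
      exact hxy
    have h3 : |a| / π ≤ |sin (a / 2)| := by
      have := Real.mul_abs_le_abs_sin (x := a / 2) (by rw [abs_div]; simp; linarith)
      rw [abs_div] at this
      refine le_trans (le_of_eq ?_) this
      simp
    rw [Metric.mem_closedBall, dist_eq_norm]
    change ‖x - (b : AddCircle (2 * π))‖ ≤ _
    rw [← hab]
    refine (QuotientAddGroup.norm_mk_le_norm).trans ?_
    rw [div_le_iff₀ Real.pi_pos] at h3
    rw [Real.norm_eq_abs]
    nlinarith [Real.pi_pos]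
  refine (measure_mono hsub).trans ?_
  rw [AddCircle.volume_closedBall]
  exact ENNReal.ofReal_le_ofReal (min_le_right _ _)

/-! ### Three unexplored points -/

/-- A set of less than a third of the circle misses three points at given arc distance. -/
lemma exists_three_notMem {V : Set (AddCircle (2 * π))} {L : ℝ}
    (hV : volume V ≤ ENNReal.ofReal L) (hL : 3 * L < 2 * π) (β : AddCircle (2 * π)) :
    ∃ x, x ∉ V ∧ x + β ∉ V ∧ x + 2 • β ∉ V := by
  by_contra! h
  have hcov : (univ : Set (AddCircle (2 * π))) ⊆
      V ∪ ((fun x => x + β) ⁻¹' V ∪ (fun x => x + 2 • β) ⁻¹' V) := by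
    intro x _
    by_cases h1 : x ∈ V
    · exact Or.inl h1
    by_cases h2 : x + β ∈ V
    · exact Or.inr (Or.inl h2)
    · exact Or.inr (Or.inr (h x h1 h2))
  have h3 : volume (univ : Set (AddCircle (2 * π))) ≤ volume V + (volume V + volume V) := by
    refine (measure_mono hcov).trans ((measure_union_le _ _).trans ?_)
    gcongr
    refine (measure_union_le _ _).trans ?_
    rw [measure_preimage_add_right, measure_preimage_add_right]
  rw [AddCircle.measure_univ] at h3
  have h4 : ENNReal.ofReal (2 * π) ≤ ENNReal.ofReal (3 * L) := by
    calc _ ≤ _ := h3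
      _ ≤ ENNReal.ofReal L + (ENNReal.ofReal L + ENNReal.ofReal L) := by gcongr
      _ = 3 * ENNReal.ofReal L := by ring
      _ = _ := by rw [ENNReal.ofReal_mul (by norm_num)]; simp
  rw [ENNReal.ofReal_le_ofReal_iff'] at h4
  rcases h4 with h4 | h4 <;> linarith [Real.pi_pos]


/-- The strict bound on `t₀` leaves room to exclude also the surroundings of both robots. The radius
`r` depends on `t₀` alone, so it can serve as a uniform time step in `exists_fresh`. -/
lemma exists_three_unvisited {t₀ : ℝ≥0} (ht₀ : (t₀ : ℝ) < 1 + π / 3) :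
    ∃ r : ℝ≥0, 0 < r ∧ ∀ ρ : Fin 2 → ℝ≥0 → ℂ, (∀ i, LipschitzWith 1 (ρ i)) → (∀ i, ρ i 0 = 0) →
      ∀ t ≤ t₀, ∀ β : AddCircle (2 * π), ∃ x : AddCircle (2 * π),
        ∀ y, y = x ∨ y = x + β ∨ y = x + 2 • β →
          ∀ i, (∀ s ≤ t, ρ i s ≠ circlePoint y) ∧ r < ‖circlePoint y - ρ i t‖ := by
  have hpi := Real.pi_pos
  obtain ⟨B, hB0, hBt, hB⟩ : ∃ B : ℝ, 0 ≤ B ∧ (t₀ : ℝ) - 1 ≤ B ∧ B < π / 3 :=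
    ⟨max 0 (t₀ - 1), le_max_left _ _, le_max_right _ _, max_lt (by positivity) (by linarith)⟩
  obtain ⟨δ, hδ0, hδ1, hδ⟩ : ∃ δ : ℝ, 0 < δ ∧ δ < 1 ∧ (1 - δ ^ 2)⁻¹ * B < π / 3 := by
    set q := B / (π / 3) with hq
    have hq0 : 0 ≤ q := by positivity
    have hq1 : q < 1 := by rw [hq, div_lt_one (by positivity)]; exact hB
    have hBq : B = q * (π / 3) := by rw [hq]; field_simp
    refine ⟨(1 - q) / 2, by linarith, by linarith, ?_⟩
    have hk : q < 1 - ((1 - q) / 2) ^ 2 := by nlinarith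
    rw [inv_mul_lt_iff₀ (by linarith), hBq]
    exact mul_lt_mul_of_pos_right hk (by positivity)
  set C := (1 - δ ^ 2)⁻¹ * B with hC
  have hr : 0 < (π / 3 - C) / (4 * π) := by
    apply div_pos <;> linarith
  -- With `4πr = π / 3 - C`, the visited and nearby arcs of both robots measure at most `2C + 4πr =
  -- C + π / 3 < 2π / 3`.
  refine ⟨⟨(π / 3 - C) / (4 * π), hr.le⟩, hr, ?_⟩
  intro ρ hρ hρ0 t ht β
  set r := (π / 3 - C) / (4 * π) with hrdef
  have hr4 : 4 * (π * r) = π / 3 - C := by rw [hrdef]; field_simp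
  have hk : 0 < 1 - δ ^ 2 := by nlinarith
  let γ : Fin 2 → ℝ → ℂ := fun i s => ρ i s.toNNReal
  have hγ : ∀ i, LipschitzWith 1 (γ i) := fun i => by
    have h := (hρ i).comp Real.lipschitzWith_toNNReal
    rwa [one_mul] at h
  let V : Fin 2 → Set (AddCircle (2 * π)) := fun i =>
    {x | ∃ s ∈ Icc (0 : ℝ) t, γ i s = circlePoint x} ∪ {x | ‖circlePoint x - ρ i t‖ ≤ r}
  have hC0 : 0 ≤ C := mul_nonneg (inv_nonneg.2 hk.le) hB0
  have hVi : ∀ i, volume (V i) ≤ ENNReal.ofReal (C + 2 * (π * r)) := fun i => by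
    rw [ENNReal.ofReal_add hC0 (by positivity)]
    refine (measure_union_le _ _).trans (add_le_add ?_ (volume_near_le _ r))
    refine (volume_visited_le (hγ i) (by simp [γ, hρ0]) t hδ0 hδ1).trans
      (ENNReal.ofReal_le_ofReal ?_)
    have : (t : ℝ) ≤ t₀ := by exact_mod_cast ht
    exact mul_le_mul_of_nonneg_left (by linarith) (inv_nonneg.2 hk.le)
  have hV : volume (V 0 ∪ V 1) ≤ ENNReal.ofReal (2 * (C + 2 * (π * r))) := by
    rw [two_mul (C + _), ENNReal.ofReal_add (by positivity) (by positivity)]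
    exact (measure_union_le _ _).trans (add_le_add (hVi 0) (hVi 1))
  obtain ⟨x, hx, hx1, hx2⟩ := exists_three_notMem hV (by linarith) β
  refine ⟨x, fun y hy i => ?_⟩
  have hyV : y ∉ V 0 ∪ V 1 := by rcases hy with rfl | rfl | rfl <;> assumption
  have hyi : y ∉ V i := fun h => hyV (by
    fin_cases i
    · exact Or.inl h
    · exact Or.inr h)
  refine ⟨fun s hs h => hyi (Or.inl ⟨s, ⟨s.2, by exact_mod_cast hs⟩, by simpa [γ] using h⟩), ?_⟩
  by_contra! h
  exact hyi (Or.inr h)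

/-! ### Induction along continuous time -/

lemma nnreal_induction {p : ℝ≥0 → Prop} (hc : IsClosed {t | p t}) (h0 : p 0)
    (hs : ∀ t, (∀ s ≤ t, p s) → ∃ δ > 0, ∀ s, t ≤ s → s < t + δ → p s) (t : ℝ≥0) : p t := by
  by_contra ht
  set S : Set ℝ≥0 := {t | ¬ p t} with hS
  have hne : S.Nonempty := ⟨t, ht⟩
  have hlt : ∀ s < sInf S, p s := fun s h => by
    by_contra hps
    exact absurd (csInf_le (OrderBot.bddBelow S) (show s ∈ S from hps)) (not_le.2 h)
  have hinf : p (sInf S) := by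
    rcases eq_or_ne (sInf S) 0 with h | h
    · rw [h]; exact h0
    · have h1 : sInf S ∈ closure (Iio (sInf S)) := by
        rw [closure_Iio' ⟨0, pos_iff_ne_zero.2 h⟩]
        exact self_mem_Iic
      exact hc.closure_subset_iff.2 (fun s hs => hlt s hs) h1
  obtain ⟨δ, hδ, h⟩ := hs (sInf S) fun s hs' =>
    hs'.lt_or_eq.elim (hlt s) fun h => h ▸ hinf
  obtain ⟨s, hsS, hsδ⟩ := exists_lt_of_csInf_lt hne (lt_add_of_pos_right (sInf S) hδ)
  exact hsS (h s (csInf_le (OrderBot.bddBelow S) hsS) hsδ)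

/-- An open condition on time persists for a while. -/
lemma exists_forall_lt_add {U : Set ℝ≥0} (hU : IsOpen U) {t : ℝ≥0} (ht : t ∈ U) :
    ∃ δ > 0, ∀ s, t ≤ s → s < t + δ → s ∈ U := by
  obtain ⟨ε, hε, h⟩ := Metric.isOpen_iff.1 hU t ht
  refine ⟨⟨ε, hε.le⟩, hε, fun s hs hs' => h ?_⟩
  have h1 : (t : ℝ) ≤ s := by exact_mod_cast hs
  have h2 : (s : ℝ) < t + ε := by exact_mod_cast hs'
  rw [Metric.mem_ball, NNReal.dist_eq, abs_of_nonneg (by linarith)]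
  linarith

/-! ### Runs in which nothing has been found yet -/

namespace F2FAlgorithm

variable {α : ℝ} (A : F2FAlgorithm α)

/-- Up to time `t`, no robot has been at the hiding place of the treasure or at the exit. -/
def Fresh (P : Placement α) (t : ℝ≥0) : Prop :=
  ∀ s ≤ t, ∀ i, A.robot P i s ≠ P.treasure ∧ A.robot P i s ≠ P.exit

variable {A}

lemma Fresh.mono {P : Placement α} {s t : ℝ≥0} (h : A.Fresh P t) (hs : s ≤ t) : A.Fresh P s :=
  fun u hu => h u (hu.trans hs)

variable (A)

lemma fresh_zero (P : Placement α) : A.Fresh P 0 := by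
  intro s hs i
  rw [nonpos_iff_eq_zero.1 hs, A.robot_zero]
  constructor
  · intro h; simpa [← h] using P.norm_treasure
  · intro h; simpa [← h] using P.norm_exit

lemma treasure_eq_of_unvisited {P : Placement α} {t : ℝ≥0}
    (h : ∀ s ≤ t, ∀ i, A.robot P i s ≠ P.treasure) {s : ℝ≥0} (hs : s ≤ t) :
    A.treasure P s = P.treasure := by
  have hTc : Continuous (A.treasure P) := (A.treasure_speed P).continuous
  suffices H : ∀ s, A.treasure P (min s t) = P.treasure by simpa [hs] using H s
  apply nnreal_induction
  · exact isClosed_eq (hTc.comp (continuous_id.min continuous_const)) continuous_const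
  · simp [A.treasure_zero]
  · intro s hs
    have hm := hs s le_rfl
    have hU : IsOpen {u | ∀ i, A.robot P i u ≠ A.treasure P u} := by
      simp only [ofPred_forall]
      exact isOpen_iInter_of_finite fun i =>
        isOpen_ne_fun (A.robot_speed P i).continuous hTc
    obtain ⟨δ, hδ, hd⟩ := exists_forall_lt_add hU (t := min s t)
      (fun i => by rw [hm]; exact h _ (min_le_right _ _) i)
    refine ⟨δ, hδ, fun u hsu hu => ?_⟩
    rw [← hm]
    refine (A.treasure_rest P _ _ (min_le_min_right _ hsu) fun w hw hwu i => ?_).symm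
    refine hd w hw (hwu.trans_lt ?_) i
    rcases le_total s t with hst | hst
    · rw [min_eq_left hst]; exact (min_le_left _ _).trans_lt hu
    · rw [min_eq_right hst]; exact (min_le_right _ _).trans_lt (lt_add_of_pos_right _ hδ)

variable {A}

lemma Fresh.treasure_eq {P : Placement α} {t : ℝ≥0} (h : A.Fresh P t) {s : ℝ≥0} (hs : s ≤ t) :
    A.treasure P s = P.treasure :=
  A.treasure_eq_of_unvisited (fun u hu i => (h u hu i).1) hs

/-- Every difference in a robot's information starts with a robot at an exit or a treasure, which is
excluded so far. The treasure itself may differ from the start, so the induction shows that only the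
treasure can. -/
lemma Fresh.not_differs {P Q : Placement α} {t : ℝ≥0} (hP : A.Fresh P t) (hQ : A.Fresh Q t)
    (i : Fin 2) : ∀ s ≤ t, ¬ Differs A.toBehaviour P Q (.robot i) s := by
  have key : ∀ b s, Differs A.toBehaviour P Q b s → s ≤ t → b = .treasure := by
    intro b s h
    induction h with
    | seeExit i s _ h => exact fun hs => (h.elim (hP s hs i).2 (hQ s hs i).2).elim
    | seeTreasure i s _ _ h _ =>
      intro hs
      rw [hP.treasure_eq hs, hQ.treasure_eq hs] at h
      exact (h.elim (hP s hs i).1 (hQ s hs i).1).elim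
    | meet i j s _ _ ih => exact fun hs => nomatch ih hs
    | remember i s u hsu _ ih => exact fun hu => nomatch ih (hsu.trans hu)
    | hidden _ => exact fun _ => rfl
    | handle => exact fun _ => rfl
    | apart => exact fun _ => rfl
  exact fun s hs h => nomatch key _ s h hs

lemma Fresh.robot_eq {P Q : Placement α} {t : ℝ≥0} (hP : A.Fresh P t) (hQ : A.Fresh Q t)
    (i : Fin 2) {s : ℝ≥0} (hs : s ≤ t) : A.robot P i s = A.robot Q i s :=
  A.robot_causal P Q i s (hP.not_differs hQ i s hs)

/-- If nothing has been found under `P`, then nothing has been found under any placement at points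
that have not been visited. -/
lemma Fresh.of_unvisited {P Q : Placement α} {t : ℝ≥0} (hP : A.Fresh P t)
    (h : ∀ s ≤ t, ∀ i, A.robot P i s ≠ Q.treasure ∧ A.robot P i s ≠ Q.exit) : A.Fresh Q t := by
  suffices H : ∀ s, A.Fresh Q (min s t) by simpa using H t
  intro s
  suffices H : ∀ s i, A.robot Q i (min s t) = A.robot P i (min s t) by
    intro u hu i
    have h1 : u ≤ t := hu.trans (min_le_right _ _)
    have h2 := H u i
    rw [min_eq_left h1] at h2
    rw [h2]
    exact h u h1 i
  apply nnreal_induction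
  · simp only [ofPred_forall]
    exact isClosed_iInter fun i => isClosed_eq
      ((A.robot_speed Q i).continuous.comp (continuous_id.min continuous_const))
      ((A.robot_speed P i).continuous.comp (continuous_id.min continuous_const))
  · simp [A.robot_zero]
  · intro s hs
    have hU : IsOpen {u | ∀ i, A.robot Q i u ≠ Q.treasure ∧ A.robot Q i u ≠ Q.exit} := by
      simp only [ofPred_forall]
      exact isOpen_iInter_of_finite fun i =>
        (isOpen_ne_fun (A.robot_speed Q i).continuous continuous_const).inter
        (isOpen_ne_fun (A.robot_speed Q i).continuous continuous_const)
    obtain ⟨δ, hδ, hd⟩ := exists_forall_lt_add hU (t := min s t)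
      (fun i => by rw [hs s le_rfl]; exact h _ (min_le_right _ _) i)
    refine ⟨δ, hδ, fun u hsu hu i => ?_⟩
    have hut : min u t < min s t + δ := by
      rcases le_total s t with hst | hst
      · rw [min_eq_left hst]; exact (min_le_left _ _).trans_lt hu
      · rw [min_eq_right hst]; exact (min_le_right _ _).trans_lt (lt_add_of_pos_right _ hδ)
    -- Up to now the runs agree and `P` avoids the points of `Q`; shortly afterwards, continuity
    -- keeps the robots of `Q` off these points.
    have hQ : A.Fresh Q (min u t) := by
      intro w hw j
      rcases le_total w (min s t) with hws | hws
      · have h2 := hs w (hws.trans (min_le_left _ _)) j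
        rw [min_eq_left (hws.trans (min_le_right _ _))] at h2
        rw [h2]
        exact h w (hws.trans (min_le_right _ _)) j
      · exact hd w hws (hw.trans_lt hut) j
    exact hQ.robot_eq (hP.mono (min_le_right _ _)) i le_rfl

/-! ### Cones of information -/

/-- After time `t₀`, points of the cone with apex `v` at time `t₀`: whoever learns something at `v`
after time `t₀`, directly or not, is in this cone. -/
def InCone (t₀ : ℝ≥0) (v z : ℂ) (t : ℝ≥0) : Prop := ‖z - v‖ ≤ (t : ℝ) - t₀

lemma InCone.robot_mono {P : Placement α} {i : Fin 2} {t₀ s t : ℝ≥0} {v : ℂ}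
    (h : InCone t₀ v (A.robot P i s) s) (hst : s ≤ t) : InCone t₀ v (A.robot P i t) t := by
  have h1 := (A.robot_speed P i).dist_le_mul t s
  have h2 : (s : ℝ) ≤ t := by exact_mod_cast hst
  rw [dist_eq_norm, NNReal.dist_eq, abs_of_nonneg (by linarith), NNReal.coe_one, one_mul] at h1
  have h3 := norm_sub_le_norm_sub_add_norm_sub (A.robot P i t) (A.robot P i s) v
  unfold InCone at *
  linarith

lemma isClosed_inCone (P : Placement α) (i : Fin 2) (t₀ : ℝ≥0) (v : ℂ) :
    IsClosed {t | InCone t₀ v (A.robot P i t) t} :=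
  isClosed_le (((A.robot_speed P i).continuous.sub continuous_const).norm)
    (NNReal.continuous_coe.sub continuous_const)

lemma Fresh.inCone_exit {P : Placement α} {i : Fin 2} {t₀ t : ℝ≥0} (hP : A.Fresh P t₀)
    (h : A.robot P i t = P.exit) : InCone t₀ P.exit (A.robot P i t) t := by
  have ht : t₀ ≤ t := by
    by_contra! ht
    exact (hP t ht.le i).2 h
  have ht' : (t₀ : ℝ) ≤ t := by exact_mod_cast ht
  simpa [InCone, h] using ht'

lemma Fresh.inCone_treasure {P : Placement α} {i : Fin 2} {t₀ t : ℝ≥0} (hP : A.Fresh P t₀)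
    (h : A.robot P i t = A.treasure P t) : InCone t₀ P.treasure (A.robot P i t) t := by
  have ht : t₀ ≤ t := by
    by_contra! ht
    rw [hP.treasure_eq ht.le] at h
    exact (hP t ht.le i).1 h
  have ht' : (t₀ : ℝ) ≤ t := by exact_mod_cast ht
  have h1 := (A.treasure_speed P).dist_le_mul t t₀
  rw [dist_eq_norm, NNReal.dist_eq, abs_of_nonneg (by linarith), NNReal.coe_one, one_mul,
    hP.treasure_eq le_rfl] at h1
  rwa [InCone, h]

/-- If in both runs a robot is in a cone at the same times, then only robots in a cone have
different information. -/
lemma inCone_of_differs {κ : Type*} {v : κ → ℂ} {P Q : Placement α} {t₀ t : ℝ≥0}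
    (hP : A.Fresh P t₀) (hQ : A.Fresh Q t₀)
    (hPt : P.treasure ∈ range v) (hPe : P.exit ∈ range v)
    (hQt : Q.treasure ∈ range v) (hQe : Q.exit ∈ range v)
    (hiff : ∀ s ≤ t, ∀ i, (∃ k, InCone t₀ (v k) (A.robot P i s) s) ↔
      ∃ k, InCone t₀ (v k) (A.robot Q i s) s)
    {i : Fin 2} {s : ℝ≥0} (hs : s ≤ t) (h : Differs A.toBehaviour P Q (.robot i) s) :
    ∃ k, InCone t₀ (v k) (A.robot P i s) s := by
  -- No claim about the treasure is needed: wherever it has been carried, speed one keeps it, and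
  -- whoever is with it, in the cone of its hiding place.
  have key : ∀ b s, Differs A.toBehaviour P Q b s → s ≤ t → ∀ i, b = .robot i →
      ∃ k, InCone t₀ (v k) (A.robot P i s) s := by
    intro b s h
    induction h with
    | seeExit i s _ h =>
      rintro hs _ ⟨⟩
      rcases h with h | h
      · obtain ⟨k, hk⟩ := hPe
        exact ⟨k, hk ▸ hP.inCone_exit h⟩
      · obtain ⟨k, hk⟩ := hQe
        exact (hiff s hs i).2 ⟨k, hk ▸ hQ.inCone_exit h⟩
    | seeTreasure i s _ _ h _ =>
      rintro hs _ ⟨⟩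
      rcases h with h | h
      · obtain ⟨k, hk⟩ := hPt
        exact ⟨k, hk ▸ hP.inCone_treasure h⟩
      · obtain ⟨k, hk⟩ := hQt
        exact (hiff s hs i).2 ⟨k, hk ▸ hQ.inCone_treasure h⟩
    | meet i j s _ h ih =>
      rintro hs _ ⟨⟩
      have hj := ih hs j rfl
      rcases h with h | h
      · rwa [h]
      · rw [hiff s hs i, h]
        exact (hiff s hs j).1 hj
    | remember i s u hsu _ ih =>
      rintro hu _ ⟨⟩
      obtain ⟨k, hk⟩ := ih (hsu.trans hu) i rfl
      exact ⟨k, hk.robot_mono hsu⟩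
    | hidden _ => exact fun _ _ h => nomatch h
    | handle => exact fun _ _ h => nomatch h
    | apart => exact fun _ _ h => nomatch h
  exact key _ s h hs i rfl

/-- Information travels with speed at most one: in two runs in which nothing has been found up to
time `t₀`, a robot is at the same point, unless it is in a common cone. -/
lemma robot_eq_or_inCone {κ : Type*} [Finite κ] {v : κ → ℂ} {P Q : Placement α} {t₀ : ℝ≥0}
    (hP : A.Fresh P t₀) (hQ : A.Fresh Q t₀)
    (hPt : P.treasure ∈ range v) (hPe : P.exit ∈ range v)
    (hQt : Q.treasure ∈ range v) (hQe : Q.exit ∈ range v) (t : ℝ≥0) :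
    ∀ i, A.robot P i t = A.robot Q i t ∨
      ∃ k, InCone t₀ (v k) (A.robot P i t) t ∧ InCone t₀ (v k) (A.robot Q i t) t := by
  revert t
  apply nnreal_induction
  · have : {t | ∀ i, A.robot P i t = A.robot Q i t ∨
        ∃ k, InCone t₀ (v k) (A.robot P i t) t ∧ InCone t₀ (v k) (A.robot Q i t) t} =
        ⋂ i, ({t | A.robot P i t = A.robot Q i t} ∪
          ⋃ k, ({t | InCone t₀ (v k) (A.robot P i t) t} ∩
            {t | InCone t₀ (v k) (A.robot Q i t) t})) := by
      ext t; simp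
    rw [this]
    exact isClosed_iInter fun i =>
      (isClosed_eq (A.robot_speed P i).continuous (A.robot_speed Q i).continuous).union
      (isClosed_iUnion_of_finite fun k => (isClosed_inCone P i t₀ _).inter
        (isClosed_inCone Q i t₀ _))
  · exact fun i => Or.inl (by rw [A.robot_zero, A.robot_zero])
  · intro t ht
    let C : Placement α → Fin 2 → ℝ≥0 → Prop := fun X i s =>
      ∃ k, InCone t₀ (v k) (A.robot X i s) s
    let J : Fin 2 → ℝ≥0 → Prop := fun i s =>
      ∃ k, InCone t₀ (v k) (A.robot P i s) s ∧ InCone t₀ (v k) (A.robot Q i s) s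
    -- A common cone is never left. Outside one, the runs agree at present and the robot is in no
    -- cone at all; this is an open condition, so it persists for a while.
    have hJ : ∀ i s u, s ≤ u → J i s → J i u := fun i s u hsu ⟨k, h1, h2⟩ =>
      ⟨k, h1.robot_mono hsu, h2.robot_mono hsu⟩
    have hCo : ∀ X i, IsOpen {s | ¬ C X i s} := fun X i => by
      have : {s | ¬ C X i s} = (⋃ k, {s | InCone t₀ (v k) (A.robot X i s) s})ᶜ := by
        ext s; simp [C]
      rw [this]
      exact (isClosed_iUnion_of_finite fun k => isClosed_inCone X i t₀ _).isOpen_compl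
    have hout : ∀ i s, s ≤ t → ¬ J i s → ¬ C P i s ∧ ¬ C Q i s := by
      intro i s hs hj
      have he := (ht s hs i).resolve_right hj
      constructor
      · rintro ⟨k, hk⟩; exact hj ⟨k, hk, he ▸ hk⟩
      · rintro ⟨k, hk⟩; exact hj ⟨k, he ▸ hk, hk⟩
    have hiff : ∀ i s, s ≤ t → (C P i s ↔ C Q i s) := by
      intro i s hs
      by_cases hj : J i s
      · obtain ⟨k, h1, h2⟩ := hj
        exact ⟨fun _ => ⟨k, h2⟩, fun _ => ⟨k, h1⟩⟩
      · exact iff_of_false (hout i s hs hj).1 (hout i s hs hj).2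
    have hU : IsOpen {s | ∀ i, J i t ∨ (¬ C P i s ∧ ¬ C Q i s)} := by
      simp only [ofPred_forall]
      refine isOpen_iInter_of_finite fun i => ?_
      exact isOpen_const.union ((hCo P i).inter (hCo Q i))
    obtain ⟨δ, hδ, hd⟩ := exists_forall_lt_add hU (t := t) fun i => by
      by_cases hj : J i t
      · exact Or.inl hj
      · exact Or.inr (hout i t le_rfl hj)
    refine ⟨δ, hδ, fun s hts hs i => ?_⟩
    rcases hd s hts hs i with hj | ⟨hp, -⟩
    · exact Or.inr (hJ i t s hts hj)
    · refine Or.inl (A.robot_causal P Q i s fun hdiff => hp ?_)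
      refine inCone_of_differs hP hQ hPt hPe hQt hQe (t := s) ?_ le_rfl hdiff
      intro u hu j
      rcases le_total u t with hut | hut
      · exact hiff j u hut
      · rcases hd u hut (hu.trans_lt hs) j with hj | ⟨h1, h2⟩
        · obtain ⟨k, h1, h2⟩ := hJ j t u hut hj
          exact ⟨fun _ => ⟨k, h2⟩, fun _ => ⟨k, h1⟩⟩
        · exact iff_of_false h1 h2

end F2FAlgorithm

/-! ### Placements that stay undiscovered -/

lemma angle_circlePoint_add {α : ℝ} (h0 : 0 ≤ α) (h1 : α ≤ π) (x : AddCircle (2 * π)) :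
    InnerProductGeometry.angle (circlePoint x) (circlePoint (x + (α : AddCircle (2 * π)))) = α := by
  obtain ⟨a, rfl⟩ := QuotientAddGroup.mk_surjective x
  change InnerProductGeometry.angle (circlePoint ((a : ℝ) : AddCircle (2 * π)))
    (circlePoint (((a : ℝ) : AddCircle (2 * π)) + (α : AddCircle (2 * π)))) = α
  rw [InnerProductGeometry.angle_comm, ← AddCircle.coe_add, circlePoint_coe, circlePoint_coe,
    Complex.angle_exp_exp, add_sub_cancel_left,
    (toIocMod_eq_self Real.two_pi_pos).2 ⟨by linarith [Real.pi_pos], by linarith⟩, abs_of_nonneg h0]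

lemma norm_circlePoint_sub_add (x : AddCircle (2 * π)) (b : ℝ) :
    ‖circlePoint x - circlePoint (x + (b : AddCircle (2 * π)))‖ = 2 * |sin (b / 2)| := by
  obtain ⟨a, rfl⟩ := QuotientAddGroup.mk_surjective x
  change ‖circlePoint ((a : ℝ) : AddCircle (2 * π)) -
    circlePoint (((a : ℝ) : AddCircle (2 * π)) + (b : AddCircle (2 * π)))‖ = _
  rw [← AddCircle.coe_add, norm_circlePoint_coe_sub, sub_add_cancel_left, neg_div, Real.sin_neg,
    abs_neg]

namespace F2FAlgorithm

variable {α : ℝ} (A : F2FAlgorithm α)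

/-- There is no run without a placement, so an undiscovered one is built in time steps of length
`r`: at each step treasure and exit are moved to unvisited points farther than `r` from both robots,
which changes nothing in the past and is safe until the next step. -/
lemma exists_fresh (h0 : 0 ≤ α) (h1 : α ≤ π) {t₀ : ℝ≥0} (ht₀ : (t₀ : ℝ) < 1 + π / 3) :
    ∃ P, A.Fresh P t₀ := by
  obtain ⟨r, hr, hx⟩ := exists_three_unvisited ht₀
  have key : ∀ n : ℕ, ∃ P, A.Fresh P (min (n * r) t₀) := by
    intro n
    induction n with
    | zero =>
      refine ⟨⟨_, _, norm_circlePoint 0, norm_circlePoint _, angle_circlePoint_add h0 h1 0⟩, ?_⟩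
      simpa using A.fresh_zero _
    | succ n ih =>
      obtain ⟨P, hP⟩ := ih
      set s := min (n * r) t₀ with hs
      obtain ⟨x, hxs⟩ := hx (A.robot P) (A.robot_speed P) (A.robot_zero P) s (min_le_right _ _) α
      let Q : Placement α :=
        ⟨_, _, norm_circlePoint x, norm_circlePoint _, angle_circlePoint_add h0 h1 x⟩
      have hQ : A.Fresh Q s := hP.of_unvisited fun u hu i =>
        ⟨(hxs x (by simp) i).1 u hu, (hxs _ (by simp) i).1 u hu⟩
      refine ⟨Q, fun u hu i => ?_⟩
      rcases le_total u s with hus | hus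
      · exact hQ u hus i
      have hur : u ≤ s + r := by
        refine hu.trans ?_
        rw [hs, min_add]
        push_cast
        rw [add_one_mul]
        exact min_le_min le_rfl le_self_add
      have hd := (A.robot_speed Q i).dist_le_mul u s
      have h2 : (s : ℝ) ≤ u := by exact_mod_cast hus
      have h3 : (u : ℝ) ≤ s + r := by exact_mod_cast hur
      rw [NNReal.dist_eq, abs_of_nonneg (by linarith), NNReal.coe_one, one_mul, dist_eq_norm,
        ← hP.robot_eq hQ i le_rfl] at hd
      constructor
      · intro h
        have h4 := (hxs x (by simp) i).2
        rw [h] at hd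
        change ‖circlePoint x - _‖ ≤ _ at hd
        linarith
      · intro h
        have h4 := (hxs (x + (α : AddCircle (2 * π))) (by simp) i).2
        rw [h] at hd
        change ‖circlePoint (x + (α : AddCircle (2 * π))) - _‖ ≤ _ at hd
        linarith
  obtain ⟨n, hn⟩ := exists_nat_ge (t₀ / r)
  obtain ⟨P, hP⟩ := key n
  rw [min_eq_right ((div_le_iff₀ hr).1 hn)] at hP
  exact ⟨P, hP⟩

/-! ### A treasure that is reached late -/

variable {A}

/-- A treasure that is at the exit at time `t` has been visited before. -/
lemma Evacuated.exists_visit {P : Placement α} {t : ℝ≥0} (h : A.Evacuated P t) {c : ℝ}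
    (hc : 0 < c) (ht : t < c + ‖P.treasure - P.exit‖) :
    ∃ i, ∃ s : ℝ≥0, (s : ℝ) < c ∧ A.robot P i s = P.treasure := by
  obtain ⟨hT, i, hi⟩ := h
  by_contra! hno
  obtain ⟨s, hs, hsc⟩ := exists_between (max_lt hc (sub_lt_iff_lt_add.2 ht))
  rw [max_lt_iff] at hs
  lift s to ℝ≥0 using hs.1.le
  have hTs : ∀ u ≤ s, A.treasure P u = P.treasure := fun u hu =>
    A.treasure_eq_of_unvisited (fun u hu i => hno i u
      (lt_of_le_of_lt (by exact_mod_cast hu) hsc)) hu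
  -- If `t ≤ s`, the treasure has not moved, so it was hidden at the exit, and the robot demanded by
  -- `Evacuated` is the visitor.
  rcases le_total t s with hts | hts
  · refine hno i t (lt_of_le_of_lt (by exact_mod_cast hts) hsc) ?_
    rw [hi, ← hT, hTs t hts]
  · have hd := (A.treasure_speed P).dist_le_mul s t
    have h2 : (s : ℝ) ≤ t := by exact_mod_cast hts
    rw [dist_comm (s : ℝ≥0), NNReal.dist_eq, abs_of_nonneg (by linarith), NNReal.coe_one, one_mul,
      dist_eq_norm, hT, hTs s le_rfl] at hd
    linarith [hs.2]

/-- Treasures at points that are far from each other cannot all be found soon. -/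
lemma not_forall_visited {v : Fin 3 → ℂ} {t₀ : ℝ≥0} {m : ℝ}
    (hv : ∀ k l, k ≠ l → m ≤ ‖v k - v l‖) (P : Fin 3 → Placement α)
    (hP : ∀ k, A.Fresh (P k) t₀) (hT : ∀ k, (P k).treasure = v k)
    (hE : ∀ k, (P k).exit ∈ range v) :
    ¬ ∀ k, ∃ i, ∃ s : ℝ≥0, (s : ℝ) < t₀ + m ∧ A.robot (P k) i s = (P k).treasure := by
  intro h
  choose i s hs hi using h
  have hT' : ∀ k, (P k).treasure ∈ range v := fun k => ⟨k, (hT k).symm⟩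
  have h0 : ∀ k, (t₀ : ℝ) ≤ s k := by
    intro k
    by_contra! hk
    exact (hP k (s k) (by exact_mod_cast hk.le) (i k)).1 (hi k)
  have key : ∀ k l, k ≠ l → i k = i l → s k ≤ s l → False := by
    intro k l hkl hil hskl
    have hskl' : (s k : ℝ) ≤ s l := by exact_mod_cast hskl
    have hl := hi l
    rw [← hil, hT] at hl
    have hk := hi k
    rw [hT] at hk
    -- At time `s k` robot `i k` is at `v k` in run `k`. Either it is there in run `l` too and must
    -- still travel to `v l`, or both runs share a cone, whose apex can only be `v k` because the
    -- others are too far.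
    rcases robot_eq_or_inCone (hP k) (hP l) (hT' k) (hE k) (hT' l) (hE l) (s k) (i k) with
      h | ⟨j, h1, h2⟩
    · have hd := (A.robot_speed (P l) (i k)).dist_le_mul (s l) (s k)
      rw [NNReal.dist_eq, abs_of_nonneg (by linarith), NNReal.coe_one, one_mul, dist_eq_norm,
        ← h, hl, hk] at hd
      linarith [hv l k hkl.symm, hs l, h0 k]
    · have hjk : j = k := by
        by_contra hjk
        rw [InCone, hk] at h1
        linarith [hv k j (Ne.symm hjk), hs k]
      subst hjk
      have h3 := h2.robot_mono hskl
      rw [InCone, hl] at h3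
      linarith [hv l j hkl.symm, hs l]
  obtain ⟨k, l, hkl, hil⟩ := Fintype.exists_ne_map_eq_of_card_lt i (by simp)
  rcases le_total (s k) (s l) with h | h
  · exact key k l hkl hil h
  · exact key l k hkl.symm hil.symm h

/-! ### The lower bound -/

variable (A)

lemma le_worstCaseTime (h0 : 0 ≤ α) (h1 : α ≤ π) {m : ℝ} (hm0 : 0 ≤ m)
    (hm1 : m ≤ 2 * sin (α / 2)) (hm2 : m ≤ 2 * sin α) :
    ENNReal.ofReal (1 + π / 3 + m + 2 * sin (α / 2)) ≤ A.worstCaseTime := by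
  by_contra! hlt
  have hw : A.worstCaseTime.toReal < 1 + π / 3 + m + 2 * sin (α / 2) :=
    (ENNReal.lt_ofReal_iff_toReal_lt hlt.ne_top).1 hlt
  obtain ⟨t₀, ht, ht₀⟩ := exists_between
    (show max 0 (A.worstCaseTime.toReal - m - 2 * sin (α / 2)) < 1 + π / 3 from
      max_lt (by positivity) (by linarith))
  rw [max_lt_iff] at ht
  lift t₀ to ℝ≥0 using ht.1.le
  obtain ⟨P₀, hP₀⟩ := A.exists_fresh h0 h1 ht₀
  obtain ⟨r, -, hx⟩ := exists_three_unvisited ht₀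
  obtain ⟨x, hx⟩ := hx (A.robot P₀) (A.robot_speed P₀) (A.robot_zero P₀) t₀ le_rfl α
  set β := (α : AddCircle (2 * π)) with hβ
  have hx2 : x + β + β = x + 2 • β := by rw [two_nsmul, add_assoc]
  have hα' : sin (α / 2) ≤ |sin (α / 2)| := le_abs_self _
  have hd : ∀ y : AddCircle (2 * π), ‖circlePoint y - circlePoint (y + β)‖ = 2 * |sin (α / 2)| :=
    fun y => norm_circlePoint_sub_add y α
  have hd2 : ‖circlePoint x - circlePoint (x + 2 • β)‖ = 2 * |sin α| := by
    have h := norm_circlePoint_sub_add x (2 * α)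
    rw [mul_div_cancel_left₀ _ two_ne_zero] at h
    rw [← h, two_nsmul, hβ, ← AddCircle.coe_add, two_mul α]
  let v : Fin 3 → ℂ := ![circlePoint x, circlePoint (x + β), circlePoint (x + 2 • β)]
  have hang := angle_circlePoint_add h0 h1
  -- The middle point is an exit for both outer treasures; its own treasure takes the exit `x`,
  -- though `x + 2α` would do as well.
  let P : Fin 3 → Placement α := ![
    ⟨_, _, norm_circlePoint x, norm_circlePoint (x + β), hang x⟩,
    ⟨_, _, norm_circlePoint (x + β), norm_circlePoint x, by
      rw [InnerProductGeometry.angle_comm]; exact hang x⟩,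
    ⟨_, _, norm_circlePoint (x + 2 • β), norm_circlePoint (x + β), by
      rw [InnerProductGeometry.angle_comm, ← hx2]; exact hang (x + β)⟩]
  have hT : ∀ k, (P k).treasure = v k := by
    intro k; fin_cases k <;> rfl
  have hE : ∀ k, (P k).exit ∈ range v := by
    intro k
    fin_cases k
    · exact ⟨1, rfl⟩
    · exact ⟨0, rfl⟩
    · exact ⟨1, rfl⟩
  have hunv : ∀ s ≤ t₀, ∀ i k, A.robot P₀ i s ≠ v k := by
    intro s hs i k
    fin_cases k
    · exact (hx _ (by simp) i).1 s hs
    · exact (hx _ (by simp) i).1 s hs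
    · exact (hx _ (by simp) i).1 s hs
  have hP : ∀ k, A.Fresh (P k) t₀ := fun k => hP₀.of_unvisited fun s hs i => by
    refine ⟨by rw [hT]; exact hunv s hs i k, ?_⟩
    obtain ⟨l, hl⟩ := hE k
    rw [← hl]
    exact hunv s hs i l
  have hd1 : ‖circlePoint (x + β) - circlePoint (x + 2 • β)‖ = 2 * |sin (α / 2)| := by
    rw [← hx2]; exact hd _
  have hv : ∀ k l, k ≠ l → m ≤ ‖v k - v l‖ := by
    have h01 : m ≤ ‖v 0 - v 1‖ := by
      change m ≤ ‖circlePoint x - circlePoint (x + β)‖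
      rw [hd]; linarith
    have h12 : m ≤ ‖v 1 - v 2‖ := by
      change m ≤ ‖circlePoint (x + β) - circlePoint (x + 2 • β)‖
      rw [hd1]; linarith
    have h02 : m ≤ ‖v 0 - v 2‖ := by
      change m ≤ ‖circlePoint x - circlePoint (x + 2 • β)‖
      rw [hd2]; linarith [le_abs_self (sin α)]
    intro k l hkl
    fin_cases k <;> fin_cases l <;>
      first
      | exact absurd rfl hkl
      | assumption
      | (rw [norm_sub_rev]; assumption)
  have hdist : ∀ k, 2 * sin (α / 2) ≤ ‖(P k).treasure - (P k).exit‖ := by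
    intro k
    fin_cases k
    · change _ ≤ ‖circlePoint x - circlePoint (x + β)‖
      rw [hd]; linarith
    · change _ ≤ ‖circlePoint (x + β) - circlePoint x‖
      rw [norm_sub_rev, hd]; linarith
    · change _ ≤ ‖circlePoint (x + 2 • β) - circlePoint (x + β)‖
      rw [norm_sub_rev, hd1]; linarith
  refine not_forall_visited hv P hP hT hE fun k => ?_
  have hk : A.evacuationTime (P k) < ENNReal.ofReal (t₀ + m + 2 * sin (α / 2)) :=
    (le_iSup A.evacuationTime (P k)).trans_lt
      ((ENNReal.lt_ofReal_iff_toReal_lt hlt.ne_top).2 (by linarith [ht.2]))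
  rw [evacuationTime] at hk
  simp only [iInf_lt_iff] at hk
  obtain ⟨t, hev, htlt⟩ := hk
  have htlt' := (ENNReal.lt_ofReal_iff_toReal_lt ENNReal.coe_ne_top).1 htlt
  rw [ENNReal.coe_toReal] at htlt'
  exact hev.exists_visit (by linarith [ht.1]) (by linarith [hdist k])

end F2FAlgorithm
end TreasureEvacuation

theorem mainTheorem3 (α : ℝ) (A : TreasureEvacuation.F2FAlgorithm α) :
    (0 ≤ α → α ≤ 2 * Real.pi / 3 →
      ENNReal.ofReal (1 + Real.pi / 3 + 4 * Real.sin (α / 2)) ≤ A.worstCaseTime) ∧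
    (2 * Real.pi / 3 ≤ α → α ≤ Real.pi →
      ENNReal.ofReal (1 + Real.pi / 3 + 2 * Real.sin α + 2 * Real.sin (α / 2)) ≤
        A.worstCaseTime) := by
  have hpi := Real.pi_pos
  have hdbl : Real.sin α = 2 * Real.sin (α / 2) * Real.cos (α / 2) := by
    rw [← Real.sin_two_mul, mul_div_cancel₀ _ two_ne_zero]
  refine ⟨fun h0 h1 => ?_, fun h0 h1 => ?_⟩
  · have hs : 0 ≤ Real.sin (α / 2) :=
      Real.sin_nonneg_of_nonneg_of_le_pi (by linarith) (by linarith)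
    -- This gives `sin α ≥ sin (α / 2)`, so the chord of `α` is the shorter one; the other case
    -- reverses it.
    have hc : 1 / 2 ≤ Real.cos (α / 2) := by
      rw [← Real.cos_pi_div_three]
      exact Real.cos_le_cos_of_nonneg_of_le_pi (by linarith) (by linarith) (by linarith)
    have := A.le_worstCaseTime h0 (by linarith) (m := 2 * Real.sin (α / 2)) (by linarith) le_rfl
      (by rw [hdbl]; nlinarith)
    convert! this using 2
    ring
  · have hs : 0 ≤ Real.sin (α / 2) :=
      Real.sin_nonneg_of_nonneg_of_le_pi (by linarith) (by linarith)
    have hc : Real.cos (α / 2) ≤ 1 / 2 := by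
      rw [← Real.cos_pi_div_three]
      exact Real.cos_le_cos_of_nonneg_of_le_pi (by linarith) (by linarith) (by linarith)
    have hsα : 0 ≤ Real.sin α := Real.sin_nonneg_of_nonneg_of_le_pi (by linarith) h1
    exact A.le_worstCaseTime (by linarith) h1 (m := 2 * Real.sin α) (by linarith)
      (by rw [hdbl]; nlinarith) le_rfl
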